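/- Let $K$ be a field of characteristic zero. For a finite connected simple graph $\Gamma$ with edge set $E(\Gamma)$, take one variable $x_e$ for each edge $e$, let $$F_\Gamma=\sum_{T}\prod_{e\in E(T)}x_e\in K[x_e : e\in E(\Gamma)],$$ where $T$ runs over the spanning trees of $\Gamma$, let $$H_\Gamma=\left(\frac{\partial^2F_\Gamma}{\partial x_i\,\partial x_j}\right)_{i,j\in E(\Gamma)}$$ be the Hessian matrix of $\Gamma$, and let $\tilde H_\Gamma$ be the value of $H_\Gamma$ at the point with $x_e=1$ for all $e$. Let $m,n\ge 1$ be integers with $m+n\ge 3$, and let $K_{m,n}$ be the complete bipartite graph with parts of sizes $m$ and $n$. Then $$\det\tilde H_{K_{m,n}}=(-1)^{mn-1}\,2^{(m-1)(n-1)}\,m^{(mn-m)(n-1)-1}\,n^{(mn-n)(m-1)-1}\,(m+n-1)(m+n-2).$$ Hence the Hessian $\det H_{K_{m,n}}$ is not the zero polynomial. -/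

import Mathlib

noncomputable section

/-- A set `T` of edges of `G` is (the edge set of) a spanning tree of `G` when the graph with all
the vertices of `G` and with edge set `T` is a tree. -/
def SimpleGraph.IsSpanningTreeEdges {V : Type*} (G : SimpleGraph V) (T : Finset G.edgeSet) : Prop :=
  (SimpleGraph.fromEdgeSet (Subtype.val '' (T : Set G.edgeSet))).IsTree

open Classical in
/-- The set of spanning trees of `G`, each given by its set of edges. -/
def SimpleGraph.spanningTrees {V : Type*} (G : SimpleGraph V) [Fintype G.edgeSet] :
    Finset (Finset G.edgeSet) :=
  {T | G.IsSpanningTreeEdges T}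

/-- The Kirchhoff polynomial of `G`: the sum over all spanning trees `T` of `G` of the product of
the variables of the edges of `T`; there is one variable for each edge of `G`. -/
def SimpleGraph.kirchhoffPolynomial (K : Type*) [CommRing K] {V : Type*} (G : SimpleGraph V)
    [Fintype G.edgeSet] : MvPolynomial G.edgeSet K :=
  ∑ T ∈ G.spanningTrees, ∏ e ∈ T, MvPolynomial.X e

/-- The Hessian matrix of `G`: the matrix of second partial derivatives of its Kirchhoff
polynomial. -/
def SimpleGraph.hessianMatrix (K : Type*) [CommRing K] {V : Type*} (G : SimpleGraph V)
    [Fintype G.edgeSet] : Matrix G.edgeSet G.edgeSet (MvPolynomial G.edgeSet K) :=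
  Matrix.of fun i j =>
    MvPolynomial.pderiv i (MvPolynomial.pderiv j (G.kirchhoffPolynomial K))

/-- The value of the Hessian matrix of `G` at the point all of whose coordinates are `1`. -/
def SimpleGraph.hessianMatrixAtOne (K : Type*) [CommRing K] {V : Type*} (G : SimpleGraph V)
    [Fintype G.edgeSet] : Matrix G.edgeSet G.edgeSet K :=
  (G.hessianMatrix K).map (MvPolynomial.eval fun _ => 1)

end

/-!
The Kirchhoff polynomial `F` is affine in each variable, so its second derivatives at `w` are second
differences `F (w + eᵢ + eⱼ) - F (w + eᵢ) - F (w + eⱼ) + F w`. By the matrix-tree theorem in the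
form `det (L_w + b cᵀ) = (∑ b) (∑ c) F w`, valid for all vectors `b` and `c`, such a difference
compares determinants of perturbations of `A = L_w + b cᵀ` by the rank-one Laplacians `x xᵀ` and
`y yᵀ` of the edges `i` and `j`, so it only involves the numbers `x A⁻¹ x`, `y A⁻¹ y`, `x A⁻¹ y`
and `y A⁻¹ x`.

The matrix-tree theorem comes from expanding the determinant by multilinearity in its rows, which
gives one term for each choice of a parent of every non-root vertex: the term is the weight of a
rooted spanning tree if all vertices reach the root, and zero otherwise.

For `K_{m,n}`, taking `b` and `c` to be the indicators of the two parts makes `A` block triangular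
with an explicit inverse. The Hessian is then a combination of the four Kronecker products of
identity and all-ones matrices, whose determinant is found by treating its blocks as scalars in a
commutative ring.
-/

open Finset Matrix
open scoped Kronecker Polynomial

section Determinants

variable {ι R : Type*} [CommRing R] [Fintype ι] [DecidableEq ι]

lemma det_smul_eq_zero_of_mulVec_eq_zero {M : Matrix ι ι R} {v : ι → R} (h : M *ᵥ v = 0) :
    M.det • v = 0 := by
  rw [← one_mulVec v, ← smul_mulVec, ← adjugate_mul, ← mulVec_mulVec, h, mulVec_zero]

lemma det_eq_one_of_unitriangular {M : Matrix ι ι R} {S : Type*} [LinearOrder S] (h : ι → S)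
    (hdiag : ∀ i, M i i = 1) (hoff : ∀ i j, i ≠ j → h i ≤ h j → M i j = 0) : M.det = 1 := by
  have htri : M.BlockTriangular fun i => OrderDual.toDual (h i) := fun i j (hij : h i < h j) =>
    hoff i j (fun e => hij.ne (congrArg h e)) hij.le
  have hblock (a : Sᵒᵈ) : M.toSquareBlock (fun i => OrderDual.toDual (h i)) a = 1 := by
    ext ⟨i, hi⟩ ⟨j, hj⟩
    obtain rfl | hij := eq_or_ne i j
    · simp [toSquareBlock_def, hdiag]
    · have hle : h i ≤ h j := (OrderDual.toDual.injective (hi.trans hj.symm)).le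
      simp [toSquareBlock_def, one_apply, hij, hoff i j hij hle]
  rw [htri.det]
  exact Finset.prod_eq_one fun a _ => by rw [hblock, det_one]

lemma det_updateRow_of_row_sums_eq_zero {L : Matrix ι ι R} (hL : L *ᵥ 1 = 0) (r : ι) (c : ι → R) :
    (L.updateRow r c).det = (∑ i, c i) * (L.updateRow r (Pi.single r 1)).det := by
  have hker : (L.updateRow r (c - (∑ i, c i) • Pi.single r 1)) *ᵥ 1 = 0 := by
    ext i
    obtain rfl | hi := eq_or_ne i r
    · simp [mulVec, dotProduct_one, ← Finset.mul_sum]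
    · simpa [mulVec, updateRow_ne hi] using congrFun hL i
  have hdet := congrFun (det_smul_eq_zero_of_mulVec_eq_zero hker) r
  rw [sub_eq_add_neg, ← neg_smul] at hdet
  simp only [Pi.smul_apply, Pi.one_apply, smul_eq_mul, mul_one, Pi.zero_apply] at hdet
  rw [det_updateRow_add, det_updateRow_smul] at hdet
  linear_combination hdet

lemma det_add_vecMulVec_of_sums_eq_zero {L : Matrix ι ι R} (hrow : L *ᵥ 1 = 0)
    (hcol : 1 ᵥ* L = 0) (r : ι) (b c : ι → R) :
    (L + vecMulVec b c).det =
      (∑ i, b i) * (∑ i, c i) * (L.updateRow r (Pi.single r 1)).det := by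
  have hsum : ∑ i, (1 : R) • (L + vecMulVec b c) i = (∑ i, b i) • c := by
    ext j
    have hj : ∑ i, L i j = 0 := by simpa [vecMul, one_dotProduct] using congrFun hcol j
    rw [Finset.sum_apply]
    simp [Finset.sum_add_distrib, vecMulVec_apply, Finset.sum_mul, hj]
  have hreplace :
      (L + vecMulVec b c).det = (∑ i, b i) * ((L + vecMulVec b c).updateRow r c).det := by
    have h := det_updateRow_sum (L + vecMulVec b c) r fun _ => 1
    rwa [hsum, det_updateRow_smul, one_smul, eq_comm] at h
  have hclear : ((L + vecMulVec b c).updateRow r c).det = (L.updateRow r c).det := by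
    refine det_eq_of_forall_row_eq_smul_add_const (Function.update b r 0) r (by simp) fun i j => ?_
    obtain rfl | hi := eq_or_ne i r
    · simp
    · simp [hi, vecMulVec_apply]
  rw [hreplace, hclear, det_updateRow_of_row_sums_eq_zero hrow, mul_assoc]

lemma det_add_vecMulVec_add_vecMulVec {A : Matrix ι ι R} (hA : IsUnit A.det) (x x' y y' : ι → R) :
    (A + vecMulVec x x' + vecMulVec y y').det =
      A.det * ((1 + x' ⬝ᵥ A⁻¹ *ᵥ x) * (1 + y' ⬝ᵥ A⁻¹ *ᵥ y) -
        (x' ⬝ᵥ A⁻¹ *ᵥ y) * (y' ⬝ᵥ A⁻¹ *ᵥ x)) := by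
  have hfactor : vecMulVec x x' + vecMulVec y y' = (of ![x, y])ᵀ * of ![x', y'] := by
    ext i j
    simp [mul_apply, vecMulVec_apply]
  have hentry (k l : Fin 2) : (of ![x', y'] * A⁻¹ * (of ![x, y])ᵀ) k l =
      ![x', y'] k ⬝ᵥ A⁻¹ *ᵥ ![x, y] l := by
    rw [Matrix.mul_assoc]
    rfl
  rw [add_assoc, hfactor, det_add_mul _ _ hA, det_fin_two]
  simp only [Matrix.add_apply, hentry]
  simp

lemma det_smul_one_add_smul_ones [Nonempty ι] (a b : R) :
    (a • (1 : Matrix ι ι R) + b • vecMulVec 1 1).det =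
      a ^ (Fintype.card ι - 1) * (a + Fintype.card ι * b) := by
  have hscalar : a • (1 : Matrix ι ι R) + b • vecMulVec 1 1 =
      scalar ι a - vecMulVec (-b • (1 : ι → R)) 1 := by
    ext i j
    simp [smul_one_eq_diagonal]
  have hcard : a ^ Fintype.card ι = a ^ (Fintype.card ι - 1) * a :=
    (pow_sub_one_mul Fintype.card_ne_zero a).symm
  rw [hscalar, ← eval_charpoly, charpoly_vecMulVec]
  simp only [hcard, neg_smul, neg_dotProduct, smul_dotProduct, one_dotProduct_one, smul_eq_mul,
    sub_neg_eq_add, Polynomial.eval_add, Polynomial.eval_smul, Polynomial.eval_pow,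
    Polynomial.eval_X]
  ring

lemma det_kronecker_one_ones {κ : Type*} [Fintype κ] [DecidableEq κ] [Nonempty ι] [Nonempty κ]
    (a b c d : R) :
    (a • (1 : Matrix (ι × κ) (ι × κ) R) + b • (1 ⊗ₖ vecMulVec 1 1) + c • (vecMulVec 1 1 ⊗ₖ 1) +
      d • vecMulVec 1 1).det =
    a ^ ((Fintype.card ι - 1) * (Fintype.card κ - 1)) *
      (a + Fintype.card κ * b) ^ (Fintype.card ι - 1) *
      (a + Fintype.card ι * c) ^ (Fintype.card κ - 1) *
      (a + Fintype.card κ * b + Fintype.card ι * c + Fintype.card ι * Fintype.card κ * d) := by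
  -- The `κ × κ` blocks are polynomials in `J`, so they commute and the determinant can be computed
  -- in two stages: over `R[X]` first, then after substituting `J` for `X`.
  let J : Matrix κ κ R := vecMulVec 1 1
  let f : R[X] →+* Matrix κ κ R := (Polynomial.aeval J).toRingHom
  let P : R[X] := .C a + .C b * .X
  let Q : R[X] := .C c + .C d * .X
  let N : Matrix ι ι R[X] := P • 1 + Q • vecMulVec 1 1
  have hf (s t : R) : f (.C s + .C t * .X) = s • 1 + t • J := by
    simp [f, Algebra.smul_def]
  have hblock : a • (1 : Matrix (ι × κ) (ι × κ) R) + b • (1 ⊗ₖ vecMulVec 1 1) +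
      c • (vecMulVec 1 1 ⊗ₖ 1) + d • vecMulVec 1 1 =
      (N.map f).comp ι ι κ κ R := by
    ext ⟨i, j⟩ ⟨k, l⟩
    have hentry : f (N i k) = (1 : Matrix ι ι R) i k • (a • 1 + b • J) + (c • 1 + d • J) := by
      obtain rfl | hik := eq_or_ne i k
      · simp [N, P, Q, hf]
      · simp [N, P, Q, hf, hik]
    rw [comp_apply, map_apply, hentry]
    simp only [Matrix.add_apply, Matrix.smul_apply, kroneckerMap_apply, J, vecMulVec_apply,
      Pi.one_apply, smul_eq_mul, mul_one, one_mul]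
    rw [← one_kronecker_one, kroneckerMap_apply]
    ring
  have hPQ : P + (Fintype.card ι : R[X]) * Q =
      .C (a + Fintype.card ι * c) + .C (b + Fintype.card ι * d) * .X := by
    simp only [P, Q, Polynomial.C_add, Polynomial.C_mul, map_natCast]
    ring
  rw [hblock, ← det_det, det_smul_one_add_smul_ones, hPQ, map_mul, map_pow, hf, hf, det_mul,
    det_pow, det_smul_one_add_smul_ones, det_smul_one_add_smul_ones, mul_pow, ← pow_mul,
    mul_comm (Fintype.card κ - 1)]
  ring

end Determinants

/-- `f` is the parent map of a tree on all of `V` rooted at `r`: the root is its own parent, and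
every vertex reaches the root by passing to the parent repeatedly. -/
structure IsParentMap {V : Type*} (r : V) (f : V → V) : Prop where
  map_root : f r = r
  exists_iterate_eq_root : ∀ v, ∃ k, f^[k] v = r

/-- The set of edges of the tree with root `r` and parent map `f`. -/
def parentEdges {V : Type*} (r : V) (f : V → V) : Set (Sym2 V) :=
  (fun v => s(v, f v)) '' {r}ᶜ

namespace IsParentMap

variable {V : Type*} {r : V} {f g : V → V}

lemma of_height (hr : f r = r) (h : V → ℕ) (hh : ∀ v, v ≠ r → h (f v) < h v) :
    IsParentMap r f := by
  refine ⟨hr, fun v => ?_⟩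
  induction hk : h v using Nat.strong_induction_on generalizing v with
  | _ k ih =>
    by_cases hv : v = r
    · exact ⟨0, hv⟩
    · obtain ⟨j, hj⟩ := ih _ (hk ▸ hh v hv) (f v) rfl
      exact ⟨j + 1, hj⟩

lemma exists_height (hf : IsParentMap r f) : ∃ h : V → ℕ, ∀ v, v ≠ r → h (f v) < h v := by
  classical
  refine ⟨fun v => Nat.find (hf.exists_iterate_eq_root v), fun v hv => ?_⟩
  obtain ⟨k, hk⟩ : ∃ k, Nat.find (hf.exists_iterate_eq_root v) = k + 1 :=
    Nat.exists_eq_succ_of_ne_zero fun h0 =>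
      hv (by simpa [h0] using Nat.find_spec (hf.exists_iterate_eq_root v))
  have hspec := Nat.find_spec (hf.exists_iterate_eq_root v)
  simp only [hk] at hspec ⊢
  exact Nat.lt_succ_of_le (Nat.find_min' _ hspec)

lemma induction_on (hf : IsParentMap r f) {p : V → Prop} (hroot : p r)
    (hstep : ∀ v, v ≠ r → p (f v) → p v) (v : V) : p v := by
  obtain ⟨k, hk⟩ := hf.exists_iterate_eq_root v
  induction k generalizing v with
  | zero => exact (show v = r from hk) ▸ hroot
  | succ k ih =>
    by_cases hv : v = r
    · exact hv ▸ hroot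
    · exact hstep v hv (ih (f v) hk)

lemma map_map_ne (hf : IsParentMap r f) {v : V} (hv : v ≠ r) : f (f v) ≠ v := by
  obtain ⟨h, hh⟩ := hf.exists_height
  intro hffv
  have hfv : f v ≠ r := fun hfv => hv (by rw [← hffv, hfv, hf.map_root])
  have hlt := (hh (f v) hfv).trans (hh v hv)
  rw [hffv] at hlt
  exact hlt.false

lemma map_ne (hf : IsParentMap r f) {v : V} (hv : v ≠ r) : f v ≠ v := fun h =>
  hf.map_map_ne hv (by rw [h, h])

lemma injOn_edge (hf : IsParentMap r f) : Set.InjOn (fun v => s(v, f v)) {r}ᶜ := by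
  intro u _ v hv huv
  obtain ⟨h, -⟩ | ⟨hu, hv'⟩ := Sym2.eq_iff.1 huv
  · exact h
  · exact absurd (hu ▸ hv') (hf.map_map_ne hv)

lemma edgeSet_fromEdgeSet (hf : IsParentMap r f) :
    (SimpleGraph.fromEdgeSet (parentEdges r f)).edgeSet = parentEdges r f := by
  rw [SimpleGraph.edgeSet_fromEdgeSet, sdiff_eq_left, Set.disjoint_left]
  rintro _ ⟨v, hv, rfl⟩ hdiag
  exact hf.map_ne hv (Sym2.mk_isDiag_iff.1 hdiag).symm

lemma isTree_fromEdgeSet [Finite V] (hf : IsParentMap r f) :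
    (SimpleGraph.fromEdgeSet (parentEdges r f)).IsTree := by
  have hreach : ∀ v, (SimpleGraph.fromEdgeSet (parentEdges r f)).Reachable r v :=
    hf.induction_on .rfl fun v hv ih => ih.trans <| SimpleGraph.Adj.reachable <|
      (SimpleGraph.fromEdgeSet_adj _).2 ⟨⟨v, hv, Sym2.eq_swap⟩, hf.map_ne hv⟩
  refine SimpleGraph.isTree_iff_connected_and_card.2
    ⟨(SimpleGraph.connected_iff_exists_forall_reachable _).2 ⟨r, hreach⟩, ?_⟩
  rw [hf.edgeSet_fromEdgeSet, Nat.card_coe_set_eq, parentEdges, hf.injOn_edge.ncard_image,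
    ← Set.ncard_singleton r, add_comm, Set.ncard_add_ncard_compl]

lemma eq_of_parentEdges_eq (hf : IsParentMap r f) (hg : IsParentMap r g)
    (h : parentEdges r f = parentEdges r g) : f = g := by
  refine funext (hf.induction_on (hf.map_root.trans hg.map_root.symm) fun v hv ih => ?_)
  obtain ⟨u, -, huv⟩ : s(v, f v) ∈ parentEdges r g := h ▸ Set.mem_image_of_mem _ hv
  obtain ⟨rfl, hu⟩ | ⟨rfl, hu⟩ := Sym2.eq_iff.1 huv
  · exact hu.symm
  · exact absurd (ih.trans hu) (hf.map_map_ne hv)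

end IsParentMap

lemma exists_adj_dist_lt {V : Type*} {H : SimpleGraph V} {r v : V} (h : H.Reachable v r)
    (hv : v ≠ r) : ∃ u, H.Adj v u ∧ H.dist u r < H.dist v r := by
  obtain ⟨p, hp⟩ := h.exists_walk_length_eq_dist
  cases p with
  | nil => exact absurd rfl hv
  | cons hadj q => exact ⟨_, hadj, hp ▸ Nat.lt_succ_of_le (SimpleGraph.dist_le q)⟩

lemma exists_isParentMap_parentEdges_eq_edgeSet {V : Type*} [Finite V] {H : SimpleGraph V}
    (hH : H.IsTree) (r : V) : ∃ f, IsParentMap r f ∧ parentEdges r f = H.edgeSet := by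
  classical
  choose! g hadj hdist using fun v (hv : v ≠ r) => 
    exists_adj_dist_lt (hH.connected v r) hv
  have hg {v : V} (hv : v ≠ r) : Function.update g r r v = g v := Function.update_of_ne hv ..
  have hf : IsParentMap r (Function.update g r r) :=
    .of_height (Function.update_self ..) (H.dist · r) fun v hv => (hg hv).symm ▸ hdist v hv
  refine ⟨_, hf, Set.eq_of_subset_of_ncard_le ?_ ?_ (Set.toFinite _)⟩
  · rintro _ ⟨v, hv, rfl⟩
    exact (show H.Adj v (Function.update g r r v) from (hg hv).symm ▸ hadj v hv)
  · have hcard := (SimpleGraph.isTree_iff_connected_and_card.1 hH).2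
    have hcard' := (SimpleGraph.isTree_iff_connected_and_card.1 hf.isTree_fromEdgeSet).2
    rw [hf.edgeSet_fromEdgeSet, Nat.card_coe_set_eq] at hcard'
    rw [Nat.card_coe_set_eq] at hcard
    omega

section WeightedLaplacian

variable {V R : Type*} [CommRing R] [DecidableEq V]

/-- The matrix whose row at `v ≠ r` is the difference of the indicators of `v` and of `f v`, and
whose row at `r` is the indicator of `r`. When `f r = r`, it detects whether `f` is the parent
map of a tree: its determinant is then `1`, and otherwise `0`. -/
def parentMatrix (R : Type*) [Ring R] (r : V) (f : V → V) : Matrix V V R :=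
  of fun v => if v = r then Pi.single r 1 else Pi.single v 1 - Pi.single (f v) 1

lemma IsParentMap.det_parentMatrix [Fintype V] {r : V} {f : V → V} (hf : IsParentMap r f) :
    (parentMatrix R r f).det = 1 := by
  obtain ⟨h, hh⟩ := hf.exists_height
  refine det_eq_one_of_unitriangular h (fun v => ?_) fun v u hvu hle => ?_
  · obtain rfl | hv := eq_or_ne v r
    · simp [parentMatrix]
    · simp [parentMatrix, hv, (hf.map_ne hv).symm]
  · obtain rfl | hv := eq_or_ne v r
    · simp [parentMatrix, hvu.symm]
    · have hu : u ≠ f v := fun hu => (hh v hv).not_ge (hu ▸ hle)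
      simp [parentMatrix, hv, hvu.symm, hu]

lemma det_parentMatrix_eq_zero [Fintype V] {r : V} {f : V → V} (hr : f r = r)
    (hf : ¬ IsParentMap r f) : (parentMatrix R r f).det = 0 := by
  classical
  let lost : V → R := fun v => if ∀ k, f^[k] v ≠ r then 1 else 0
  have hroot : lost r = 0 := if_neg fun h => h 0 rfl
  have hstep (v : V) (hv : v ≠ r) : lost (f v) = lost v :=
    if_congr ⟨fun h k => k.casesOn hv h, fun h k => h (k + 1)⟩ rfl rfl
  have hker : parentMatrix R r f *ᵥ lost = 0 := by
    ext v
    obtain rfl | hv := eq_or_ne v r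
    · simp [mulVec, parentMatrix, hroot]
    · simp only [mulVec, parentMatrix, of_apply, if_neg hv, sub_dotProduct, single_one_dotProduct,
        hstep v hv, sub_self, Pi.zero_apply]
  obtain ⟨v, hv⟩ : ∃ v, ∀ k, f^[k] v ≠ r := by
    by_contra! hreach
    exact hf ⟨hr, hreach⟩
  simpa [lost, hv] using congrFun (det_smul_eq_zero_of_mulVec_eq_zero hker) v

/-- The Laplacian of the complete graph on `V`, with weight `W e` on the edge `e`. A graph with
fewer edges is encoded by the weight `0`; the weights of the loops do not matter. -/
def weightedLaplacian [Fintype V] (W : Sym2 V → R) : Matrix V V R :=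
  diagonal (fun v => ∑ u, W s(v, u)) - of fun v u => W s(v, u)

variable [Fintype V]

lemma weightedLaplacian_row (W : Sym2 V → R) (v : V) :
    weightedLaplacian W v = ∑ u, W s(v, u) • (Pi.single v 1 - Pi.single u 1) := by
  ext u
  rw [Finset.sum_apply]
  simp [weightedLaplacian, diagonal_apply, Pi.single_apply, mul_sub, eq_comm]

lemma weightedLaplacian_add (W W' : Sym2 V → R) :
    weightedLaplacian (W + W') = weightedLaplacian W + weightedLaplacian W' := by
  ext v u
  simp only [weightedLaplacian, diagonal_apply, of_apply, Matrix.add_apply, Matrix.sub_apply,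
    Pi.add_apply, Finset.sum_add_distrib]
  split_ifs <;> ring

lemma weightedLaplacian_transpose (W : Sym2 V → R) :
    (weightedLaplacian W)ᵀ = weightedLaplacian W := by
  rw [weightedLaplacian, transpose_sub, diagonal_transpose]
  congr 1
  ext v u
  exact congrArg W Sym2.eq_swap

lemma weightedLaplacian_mulVec_one (W : Sym2 V → R) : weightedLaplacian W *ᵥ 1 = 0 := by
  ext v
  simp [mulVec, dotProduct_one, weightedLaplacian, diagonal_apply]

lemma one_vecMul_weightedLaplacian (W : Sym2 V → R) : 1 ᵥ* weightedLaplacian W = 0 := by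
  rw [← mulVec_transpose, weightedLaplacian_transpose, weightedLaplacian_mulVec_one]

lemma weightedLaplacian_single (a b : V) :
    weightedLaplacian (Pi.single s(a, b) (1 : R)) =
      vecMulVec (Pi.single a 1 - Pi.single b 1) (Pi.single a 1 - Pi.single b 1) := by
  ext v u
  have hmem (x : V) : (Pi.single s(a, b) 1 : Sym2 V → R) s(v, x) =
      if v = a then (if x = b then 1 else 0)
      else if v = b then (if x = a then 1 else 0) else 0 := by
    rw [Pi.single_apply]
    split_ifs <;> grind
  simp only [weightedLaplacian, Matrix.sub_apply, diagonal_apply, of_apply, hmem]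
  simp only [vecMulVec_apply, Pi.sub_apply, Pi.single_apply]
  split_ifs <;> simp_all

open Classical in
theorem det_updateRow_weightedLaplacian (W : Sym2 V → R) (r : V) :
    ((weightedLaplacian W).updateRow r (Pi.single r 1)).det =
      ∑ f with IsParentMap r f, ∏ v ∈ univ.erase r, W s(v, f v) := by
  -- Expanding every row by multilinearity chooses a parent `f v` for each vertex `v`.
  let coeff (v u : V) : R := if v = r then (if u = r then 1 else 0) else W s(v, u)
  let row (v u : V) : V → R := if v = r then Pi.single r 1 else Pi.single v 1 - Pi.single u 1
  have hrows : (weightedLaplacian W).updateRow r (Pi.single r 1) =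
      fun v => ∑ u, coeff v u • row v u := by
    funext v
    obtain rfl | hv := eq_or_ne v r
    · simp [coeff, row]
    · simp [coeff, row, hv, weightedLaplacian_row]
  have hexpand : ((weightedLaplacian W).updateRow r (Pi.single r 1)).det =
      ∑ f : V → V, (∏ v, coeff v (f v)) * (parentMatrix R r f).det := by
    rw [hrows]
    change detRowAlternating.toMultilinearMap _ = _
    rw [MultilinearMap.map_sum]
    exact sum_congr rfl fun f _ => MultilinearMap.map_smul_univ _ _ _
  have hprod (f : V → V) (hr : f r = r) :
      ∏ v, coeff v (f v) = ∏ v ∈ univ.erase r, W s(v, f v) := by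
    rw [← mul_prod_erase _ _ (mem_univ r)]
    simp only [coeff, hr, if_true, one_mul]
    exact prod_congr rfl fun v hv => if_neg (ne_of_mem_erase hv)
  rw [hexpand, sum_filter]
  refine sum_congr rfl fun f _ => ?_
  split_ifs with hf
  · rw [hprod f hf.map_root, hf.det_parentMatrix, mul_one]
  · by_cases hr : f r = r
    · rw [det_parentMatrix_eq_zero hr hf, mul_zero]
    · rw [prod_eq_zero (mem_univ r) (by simp [coeff, hr]), zero_mul]

end WeightedLaplacian

section MatrixTree

variable {V R : Type*} [CommRing R] {G : SimpleGraph V}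

/-- Edge weights on `G`, extended by zero to all unordered pairs of vertices. -/
noncomputable def extendWeight (w : G.edgeSet → R) : Sym2 V → R :=
  Function.extend Subtype.val w 0

lemma extendWeight_coe (w : G.edgeSet → R) (e : G.edgeSet) : extendWeight w e = w e :=
  Subtype.val_injective.extend_apply ..

lemma extendWeight_of_notMem (w : G.edgeSet → R) {e : Sym2 V} (he : e ∉ G.edgeSet) :
    extendWeight w e = 0 :=
  Function.extend_apply' _ _ _ fun ⟨e', h⟩ => he (h ▸ e'.2)

lemma extendWeight_add (w w' : G.edgeSet → R) :
    extendWeight (w + w') = extendWeight w + extendWeight w' := by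
  simp only [extendWeight, ← Function.extend_add, add_zero]

lemma extendWeight_single [DecidableEq V] (e : G.edgeSet) :
    extendWeight (Pi.single e (1 : R)) = Pi.single e.1 1 := by
  ext e'
  by_cases he' : e' ∈ G.edgeSet
  · lift e' to G.edgeSet using he'
    rw [extendWeight_coe, Pi.single_apply, Pi.single_apply]
    simp [Subtype.ext_iff]
  · rw [extendWeight_of_notMem _ he', Pi.single_eq_of_ne]
    exact fun h => he' (h ▸ e.2)

lemma edgeSet_fromEdgeSet_image_val (T : Set G.edgeSet) :
    (SimpleGraph.fromEdgeSet (Subtype.val '' T)).edgeSet = Subtype.val '' T := by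
  rw [SimpleGraph.edgeSet_fromEdgeSet, sdiff_eq_left, Set.disjoint_left]
  rintro _ ⟨e, -, rfl⟩
  exact G.not_isDiag_of_mem_edgeSet e.2

lemma IsParentMap.prod_extendWeight [Fintype V] [DecidableEq V] {r : V} {f : V → V}
    (hf : IsParentMap r f) {T : Finset G.edgeSet}
    (hT : parentEdges r f = Subtype.val '' (T : Set G.edgeSet)) (w : G.edgeSet → R) :
    ∏ v ∈ univ.erase r, extendWeight w s(v, f v) = ∏ e ∈ T, w e := by
  have himage : (univ.erase r).image (fun v => s(v, f v)) = T.image Subtype.val := by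
    apply Finset.coe_injective
    simpa [parentEdges, Set.compl_eq_univ_sdiff] using hT
  have hinj : Set.InjOn (fun v => s(v, f v)) (univ.erase r : Finset V) :=
    hf.injOn_edge.mono (by simp [Set.compl_eq_univ_sdiff])
  rw [← prod_image (f := extendWeight w) hinj, himage, prod_image Subtype.val_injective.injOn]
  simp only [extendWeight_coe]

open Classical in
lemma sum_isParentMap_prod_extendWeight [Fintype V] [DecidableEq V] [Fintype G.edgeSet]
    (w : G.edgeSet → R) (r : V) :
    ∑ f with IsParentMap r f, ∏ v ∈ univ.erase r, extendWeight w s(v, f v) =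
      ∑ T ∈ G.spanningTrees, ∏ e ∈ T, w e := by
  have : Nonempty V := ⟨r⟩
  choose! parent hparent hedges using fun (T : Finset G.edgeSet) (hT : G.IsSpanningTreeEdges T) =>
    exists_isParentMap_parentEdges_eq_edgeSet hT r
  simp only [edgeSet_fromEdgeSet_image_val] at hedges
  have hmem {T : Finset G.edgeSet} : T ∈ G.spanningTrees ↔ G.IsSpanningTreeEdges T := by
    simp [SimpleGraph.spanningTrees]
  symm
  refine Finset.sum_of_injOn parent (fun T hT T' hT' h => ?_) (fun T hT => ?_)
    (fun f hf hfT => ?_) fun T hT => ?_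
  · apply Finset.coe_injective
    rw [← Subtype.val_injective.image_injective.eq_iff, ← hedges T (hmem.1 hT),
      ← hedges T' (hmem.1 hT'), h]
  · simpa using hparent T (hmem.1 hT)
  · have hf : IsParentMap r f := by simpa using hf
    obtain ⟨_, ⟨v, hv, rfl⟩, hvG⟩ : ∃ e ∈ parentEdges r f, e ∉ G.edgeSet := by
      by_contra! hsub
      obtain ⟨T, hT⟩ :
          ∃ T : Finset G.edgeSet, Subtype.val '' (T : Set G.edgeSet) = parentEdges r f :=
        ⟨(Subtype.val ⁻¹' parentEdges r f).toFinset, by simpa [Set.subset_def] using hsub⟩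
      have htree : G.IsSpanningTreeEdges T := by
        rw [SimpleGraph.IsSpanningTreeEdges, hT]
        exact hf.isTree_fromEdgeSet
      refine hfT ⟨T, hmem.2 htree, (hparent T htree).eq_of_parentEdges_eq hf ?_⟩
      rw [hedges T htree, hT]
    exact prod_eq_zero (by simpa using hv) (extendWeight_of_notMem w hvG)
  · exact ((hparent T (hmem.1 hT)).prod_extendWeight (hedges T (hmem.1 hT)) w).symm

theorem det_weightedLaplacian_add_vecMulVec [Fintype V] [DecidableEq V] [Nonempty V]
    [Fintype G.edgeSet] (w : G.edgeSet → R) (b c : V → R) :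
    (weightedLaplacian (extendWeight w) + vecMulVec b c).det =
      (∑ v, b v) * (∑ v, c v) * MvPolynomial.eval w (G.kirchhoffPolynomial R) := by
  obtain ⟨r⟩ := ‹Nonempty V›
  rw [det_add_vecMulVec_of_sums_eq_zero (weightedLaplacian_mulVec_one _)
    (one_vecMul_weightedLaplacian _) r, det_updateRow_weightedLaplacian,
    sum_isParentMap_prod_extendWeight]
  simp [SimpleGraph.kirchhoffPolynomial]

end MatrixTree

section SecondDifferences

open MvPolynomial

variable {σ R : Type*} [DecidableEq σ]

lemma pderiv_prod_X [CommSemiring R] (T : Finset σ) (i : σ) :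
    pderiv i (∏ e ∈ T, (X e : MvPolynomial σ R)) =
      if i ∈ T then ∏ e ∈ T.erase i, X e else 0 := by
  have hzero {S : Finset σ} (hS : i ∉ S) : pderiv i (∏ e ∈ S, (X e : MvPolynomial σ R)) = 0 := by
    induction S using Finset.induction_on with
    | empty => simp
    | insert e S he ih =>
      obtain ⟨hie, hiS⟩ := not_or.1 (mem_insert.not.1 hS)
      rw [prod_insert he, Derivation.leibniz, ih hiS, pderiv_X_of_ne (Ne.symm hie)]
      simp
  split_ifs with hi
  · rw [← mul_prod_erase T X hi, Derivation.leibniz, pderiv_X_self, hzero (notMem_erase i T)]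
    simp
  · exact hzero hi

variable [CommRing R]

lemma eval_pderiv_prod_X (T : Finset σ) (i : σ) (w : σ → R) :
    eval w (pderiv i (∏ e ∈ T, X e)) =
      eval (w + Pi.single i 1) (∏ e ∈ T, X e) - eval w (∏ e ∈ T, X e) := by
  have heq {e : σ} (he : e ≠ i) : (w + Pi.single i 1 : σ → R) e = w e := by simp [he]
  rw [pderiv_prod_X]
  simp only [eval_prod, eval_X]
  split_ifs with hi
  · rw [← mul_prod_erase T _ hi, ← mul_prod_erase T _ hi,
      prod_congr rfl fun e he => heq (ne_of_mem_erase he)]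
    simp [add_mul]
  · rw [prod_congr rfl fun e he => heq (ne_of_mem_of_not_mem he hi)]
    simp

lemma eval_pderiv_pderiv_prod_X (T : Finset σ) (i j : σ) (w : σ → R) :
    eval w (pderiv i (pderiv j (∏ e ∈ T, X e))) =
      eval (w + Pi.single i 1 + Pi.single j 1) (∏ e ∈ T, X e) -
        eval (w + Pi.single i 1) (∏ e ∈ T, X e) - eval (w + Pi.single j 1) (∏ e ∈ T, X e) +
        eval w (∏ e ∈ T, X e) := by
  have hi (p : MvPolynomial σ R) (hp : p = pderiv j (∏ e ∈ T, X e)) :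
      eval w (pderiv i p) = eval (w + Pi.single i 1) p - eval w p := by
    rw [hp, pderiv_prod_X]
    split_ifs
    · exact eval_pderiv_prod_X ..
    · simp
  rw [hi _ rfl, eval_pderiv_prod_X, eval_pderiv_prod_X]
  ring

end SecondDifferences

section Hessian

variable {V R : Type*} [CommRing R] {G : SimpleGraph V} [Fintype G.edgeSet]

lemma eval_hessianMatrix [DecidableEq G.edgeSet] (i j : G.edgeSet) (w : G.edgeSet → R) :
    MvPolynomial.eval w (G.hessianMatrix R i j) =
      MvPolynomial.eval (w + Pi.single i 1 + Pi.single j 1) (G.kirchhoffPolynomial R) -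
        MvPolynomial.eval (w + Pi.single i 1) (G.kirchhoffPolynomial R) -
        MvPolynomial.eval (w + Pi.single j 1) (G.kirchhoffPolynomial R) +
        MvPolynomial.eval w (G.kirchhoffPolynomial R) := by
  simp only [SimpleGraph.hessianMatrix, of_apply, SimpleGraph.kirchhoffPolynomial, map_sum,
    eval_pderiv_pderiv_prod_X, sum_add_distrib, sum_sub_distrib]

lemma det_hessianMatrixAtOne [DecidableEq G.edgeSet] :
    (G.hessianMatrixAtOne R).det = MvPolynomial.eval (fun _ => 1) (G.hessianMatrix R).det := by
  rw [SimpleGraph.hessianMatrixAtOne, RingHom.map_det, RingHom.mapMatrix_apply]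

theorem sum_mul_sum_mul_eval_hessianMatrix [Fintype V] [DecidableEq V] {w : G.edgeSet → R}
    {b c : V → R} {A : Matrix V V R} (hA : A = weightedLaplacian (extendWeight w) + vecMulVec b c)
    (hdet : IsUnit A.det) {i j : G.edgeSet} {x y : V → R}
    (hx : weightedLaplacian (Pi.single i.1 1) = vecMulVec x x)
    (hy : weightedLaplacian (Pi.single j.1 1) = vecMulVec y y) :
    (∑ v, b v) * (∑ v, c v) * MvPolynomial.eval w (G.hessianMatrix R i j) =
      A.det * ((x ⬝ᵥ A⁻¹ *ᵥ x) * (y ⬝ᵥ A⁻¹ *ᵥ y) - (x ⬝ᵥ A⁻¹ *ᵥ y) * (y ⬝ᵥ A⁻¹ *ᵥ x)) := by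
  classical
  have : Nonempty V := ⟨i.1.out.1⟩
  have htree (u : G.edgeSet → R) (B : Matrix V V R)
      (hB : weightedLaplacian (extendWeight u) = weightedLaplacian (extendWeight w) + B) :
      (∑ v, b v) * (∑ v, c v) * MvPolynomial.eval u (G.kirchhoffPolynomial R) = (A + B).det := by
    rw [← det_weightedLaplacian_add_vecMulVec, hB, hA, add_right_comm]
  have hw := htree w 0 (add_zero _).symm
  have hwi := htree (w + Pi.single i 1) (vecMulVec x x) <| by
    rw [extendWeight_add, weightedLaplacian_add, extendWeight_single, hx]
  have hwj := htree (w + Pi.single j 1) (vecMulVec y y) <| by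
    rw [extendWeight_add, weightedLaplacian_add, extendWeight_single, hy]
  have hwij := htree (w + Pi.single i 1 + Pi.single j 1) (vecMulVec x x + vecMulVec y y) <| by
    simp only [extendWeight_add, weightedLaplacian_add, extendWeight_single, hx, hy, add_assoc]
  have hrank_one (z : V → R) : (A + vecMulVec z z).det = A.det * (1 + z ⬝ᵥ A⁻¹ *ᵥ z) := by
    simpa using det_add_vecMulVec_add_vecMulVec hdet z z 0 0
  rw [add_zero] at hw
  rw [hrank_one] at hwi hwj
  rw [← add_assoc, det_add_vecMulVec_add_vecMulVec hdet] at hwij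
  rw [eval_hessianMatrix]
  linear_combination hwij - hwi - hwj + hw

end Hessian

section CompleteBipartite

/-- The edges of a complete bipartite graph, as pairs of a vertex from each part. -/
noncomputable def completeBipartiteEdgeEquiv (α β : Type*) :
    α × β ≃ (completeBipartiteGraph α β).edgeSet :=
  Equiv.ofBijective (fun p => ⟨s(.inl p.1, .inr p.2), by simp⟩) <| by
    refine ⟨fun p q h => ?_, ?_⟩
    · simpa [Prod.ext_iff] using h
    · rintro ⟨⟨i | j, k | l⟩, he⟩
      · simp at he
      · exact ⟨(i, l), rfl⟩
      · exact ⟨(k, j), Subtype.ext Sym2.eq_swap⟩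
      · simp at he

variable {α β : Type*} [Fintype α] [Fintype β] [DecidableEq α] [DecidableEq β]

lemma weightedLaplacian_completeBipartiteGraph_add_vecMulVec {R : Type*} [CommRing R] :
    weightedLaplacian (extendWeight (1 : (completeBipartiteGraph α β).edgeSet → R)) +
        vecMulVec (Sum.elim 1 0) (Sum.elim 0 1) =
      fromBlocks ((Fintype.card β : R) • 1) 0 (-vecMulVec 1 1) ((Fintype.card α : R) • 1) := by
  have hedge (i : α) (j : β) :
      extendWeight (1 : (completeBipartiteGraph α β).edgeSet → R) s(.inl i, .inr j) = 1 :=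
    extendWeight_coe 1 ⟨s(Sum.inl i, Sum.inr j), by simp⟩
  have hleft (i k : α) :
      extendWeight (1 : (completeBipartiteGraph α β).edgeSet → R) s(.inl i, .inl k) = 0 :=
    extendWeight_of_notMem _ (by simp)
  have hright (j l : β) :
      extendWeight (1 : (completeBipartiteGraph α β).edgeSet → R) s(.inr j, .inr l) = 0 :=
    extendWeight_of_notMem _ (by simp)
  have hedge' (i : α) (j : β) :
      extendWeight (1 : (completeBipartiteGraph α β).edgeSet → R) s(.inr j, .inl i) = 1 :=
    Sym2.eq_swap ▸ hedge i j
  ext (i | j) (k | l) <;>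
    simp [weightedLaplacian, diagonal_apply, one_apply, vecMulVec_apply, hedge, hedge', hleft,
      hright]

variable {K : Type*} [Field K]

lemma dotProduct_inv_fromBlocks_mulVec {m n : K} (hm : m ≠ 0) (hn : n ≠ 0) (i k : α) (j l : β) :
    (Pi.single (.inl i) 1 - Pi.single (.inr j) 1 : α ⊕ β → K) ⬝ᵥ
        (fromBlocks (n • 1) 0 (-vecMulVec 1 1) (m • 1))⁻¹ *ᵥ
          (Pi.single (.inl k) 1 - Pi.single (.inr l) 1) =
      n⁻¹ * (1 : Matrix α α K) i k + m⁻¹ * (1 : Matrix β β K) j l - (m * n)⁻¹ := by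
  have hinv : (fromBlocks (n • (1 : Matrix α α K)) 0 (-vecMulVec 1 1) (m • (1 : Matrix β β K)))⁻¹ =
      fromBlocks (n⁻¹ • 1) 0 ((m * n)⁻¹ • vecMulVec 1 1) (m⁻¹ • 1) := by
    have hcancel : (m * n)⁻¹ * m = n⁻¹ := by field_simp
    refine inv_eq_right_inv ?_
    rw [fromBlocks_multiply, ← fromBlocks_one]
    congr 1
    · simp [hn]
    · simp
    · simp only [Matrix.mul_smul, Matrix.smul_mul, Matrix.mul_one, Matrix.one_mul, smul_smul,
        smul_neg, hcancel, neg_add_cancel]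
    · simp [hm]
  rw [hinv]
  simp only [mulVec_sub, dotProduct_sub, sub_dotProduct, mulVec_single, single_dotProduct,
    MulOpposite.op_one, one_smul, one_mul, mul_one, mul_zero, zero_sub, sub_neg_eq_add, col_apply,
    fromBlocks_apply₁₁, fromBlocks_apply₁₂, fromBlocks_apply₂₁, fromBlocks_apply₂₂,
    vecMulVec_one, replicateCol_apply, Matrix.smul_apply, Matrix.zero_apply, Pi.one_apply,
    smul_eq_mul, _root_.mul_inv_rev]
  ring

lemma hessianMatrixAtOne_completeBipartiteGraph_apply
    [Fintype (completeBipartiteGraph α β).edgeSet] {m n : K} (hm : m = Fintype.card α)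
    (hn : n = Fintype.card β) (hm0 : m ≠ 0) (hn0 : n ≠ 0) (i k : α) (j l : β) :
    (completeBipartiteGraph α β).hessianMatrixAtOne K (completeBipartiteEdgeEquiv α β (i, j))
        (completeBipartiteEdgeEquiv α β (k, l)) =
      n ^ Fintype.card α * m ^ Fintype.card β / (m * n) ^ 3 *
        ((m + n - 1) ^ 2 -
          (m * (1 : Matrix α α K) i k + n * (1 : Matrix β β K) j l - 1) ^ 2) := by
  classical
  have hA := weightedLaplacian_completeBipartiteGraph_add_vecMulVec (α := α) (β := β) (R := K)
  rw [← hm, ← hn] at hA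
  have hdet : (fromBlocks (n • (1 : Matrix α α K)) 0 (-vecMulVec 1 1)
      (m • (1 : Matrix β β K))).det = n ^ Fintype.card α * m ^ Fintype.card β := by
    simp [det_fromBlocks_zero₁₂]
  have hentry := sum_mul_sum_mul_eval_hessianMatrix (i := completeBipartiteEdgeEquiv α β (i, j))
    (j := completeBipartiteEdgeEquiv α β (k, l)) hA.symm
    (hdet ▸ (mul_ne_zero (pow_ne_zero _ hn0) (pow_ne_zero _ hm0)).isUnit)
    (weightedLaplacian_single _ _) (weightedLaplacian_single _ _)
  have hsumα : ∑ v : α ⊕ β, Sum.elim (1 : α → K) (0 : β → K) v = m := by simp [hm]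
  have hsumβ : ∑ v : α ⊕ β, Sum.elim (0 : α → K) (1 : β → K) v = n := by simp [hn]
  have hsymmα : (1 : Matrix α α K) k i = (1 : Matrix α α K) i k := by simp [one_apply, eq_comm]
  have hsymmβ : (1 : Matrix β β K) l j = (1 : Matrix β β K) j l := by simp [one_apply, eq_comm]
  simp only [hdet, dotProduct_inv_fromBlocks_mulVec hm0 hn0, hsumα, hsumβ, hsymmα, hsymmβ,
    one_apply_eq] at hentry
  refine mul_left_cancel₀ (mul_ne_zero hm0 hn0) (hentry.trans ?_)
  field_simp

lemma submatrix_hessianMatrixAtOne_completeBipartiteGraph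
    [Fintype (completeBipartiteGraph α β).edgeSet] {m n : K} (hm : m = Fintype.card α)
    (hn : n = Fintype.card β) (hm0 : m ≠ 0) (hn0 : n ≠ 0) :
    ((completeBipartiteGraph α β).hessianMatrixAtOne K).submatrix
        (completeBipartiteEdgeEquiv α β) (completeBipartiteEdgeEquiv α β) =
      (n ^ Fintype.card α * m ^ Fintype.card β / (m * n) ^ 3) •
        ((-2 * m * n) • (1 : Matrix (α × β) (α × β) K) + (-(m ^ 2 - 2 * m)) • (1 ⊗ₖ vecMulVec 1 1) +
          (-(n ^ 2 - 2 * n)) • (vecMulVec 1 1 ⊗ₖ 1) + ((m + n) * (m + n - 2)) • vecMulVec 1 1) := by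
  ext ⟨i, j⟩ ⟨k, l⟩
  -- The entries of the identity matrices are idempotent, so the square in the entry of the Hessian
  -- expands into the four Kronecker products.
  have hα : (1 : Matrix α α K) i k ^ 2 = (1 : Matrix α α K) i k := by simp [one_apply]
  have hβ : (1 : Matrix β β K) j l ^ 2 = (1 : Matrix β β K) j l := by simp [one_apply]
  rw [submatrix_apply, hessianMatrixAtOne_completeBipartiteGraph_apply hm hn hm0 hn0,
    ← one_kronecker_one]
  simp only [Matrix.smul_apply, Matrix.add_apply, kroneckerMap_apply, vecMulVec_apply,
    Pi.one_apply, smul_eq_mul, mul_one, one_mul]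
  linear_combination -(n ^ Fintype.card α * m ^ Fintype.card β / (m * n) ^ 3) *
    (m ^ 2 * hα + n ^ 2 * hβ)

end CompleteBipartite

section ClosedForm

variable {K : Type*} [Field K]

lemma zpow_eq_pow_div_pow {x : K} (hx : x ≠ 0) {e : ℤ} {a b : ℕ} (he : e = a - b) :
    x ^ e = x ^ a / x ^ b := by
  rw [he, zpow_sub₀ hx, zpow_natCast, zpow_natCast]

lemma det_hessian_factors_eq_zpow {x y : K} (hx : x ≠ 0) (hy : y ≠ 0) {m n : ℕ} (hm : m ≠ 0)
    (hn : n ≠ 0) :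
    (y ^ m * x ^ n / (x * y) ^ 3) ^ (m * n) *
        ((-2 * x * y) ^ ((m - 1) * (n - 1)) * (-(x ^ 2 * y)) ^ (m - 1) *
          (-(y ^ 2 * x)) ^ (n - 1) * (x * y)) =
      (-1) ^ (m * n - 1) * 2 ^ ((m - 1) * (n - 1)) * x ^ (((m : ℤ) * n - m) * (n - 1) - 1) *
        y ^ (((m : ℤ) * n - n) * (m - 1) - 1) := by
  obtain ⟨M, rfl⟩ := Nat.exists_eq_add_one_of_ne_zero hm
  obtain ⟨N, rfl⟩ := Nat.exists_eq_add_one_of_ne_zero hn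
  have hsign : (M + 1) * (N + 1) - 1 = M * N + M + N := by
    rw [show (M + 1) * (N + 1) = M * N + M + N + 1 by ring, Nat.add_sub_cancel]
  rw [hsign,
    zpow_eq_pow_div_pow hx (a := (N + 1) * ((M + 1) * (N + 1)) + M * N + 2 * M + N + 1)
      (b := 3 * ((M + 1) * (N + 1))) (by push_cast; ring),
    zpow_eq_pow_div_pow hy (a := (M + 1) * ((M + 1) * (N + 1)) + M * N + 2 * N + M + 1)
      (b := 3 * ((M + 1) * (N + 1))) (by push_cast; ring),
    ← neg_one_mul (x ^ 2 * y), ← neg_one_mul (y ^ 2 * x), neg_mul, neg_mul,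
    ← neg_one_mul (2 * x * y)]
  simp only [Nat.add_sub_cancel, mul_pow, div_pow, ← pow_mul, pow_add]
  field_simp
  ring

lemma two_ne_zero_of_natCast_add_ne_two {m n : ℕ} (hm : (m : K) ≠ 0) (hn : (n : K) ≠ 0)
    (hmn : (m : K) + n ≠ 2) : (2 : K) ≠ 0 := by
  intro h
  have hone {k : ℕ} (hk : (k : K) ≠ 0) : (k : K) = 1 := by
    obtain ⟨l, rfl | rfl⟩ := Nat.even_or_odd' k
    · simp [h] at hk
    · simp [h]
  exact hmn (by rw [hone hm, hone hn, one_add_one_eq_two])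

end ClosedForm

section MainTheorem

variable (K : Type*) [Field K] {α β : Type*} [Fintype α] [Fintype β]
  [Fintype (completeBipartiteGraph α β).edgeSet]

lemma det_hessianMatrixAtOne_completeBipartiteGraph
    [DecidableEq (completeBipartiteGraph α β).edgeSet] {m n : ℕ}
    (hα : Fintype.card α = m) (hβ : Fintype.card β = n) (hm : (m : K) ≠ 0) (hn : (n : K) ≠ 0) :
    ((completeBipartiteGraph α β).hessianMatrixAtOne K).det =
      ((n : K) ^ m * (m : K) ^ n / (m * n) ^ 3) ^ (m * n) *
        ((-2 * m * n) ^ ((m - 1) * (n - 1)) * (-(m ^ 2 * n)) ^ (m - 1) *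
          (-(n ^ 2 * m)) ^ (n - 1) * (m * n * (m + n - 1) * (m + n - 2))) := by
  classical
  have hm0 : m ≠ 0 := fun h => hm (by simp [h])
  have hn0 : n ≠ 0 := fun h => hn (by simp [h])
  have : Nonempty α := Fintype.card_pos_iff.1 (by omega)
  have : Nonempty β := Fintype.card_pos_iff.1 (by omega)
  rw [← det_submatrix_equiv_self (completeBipartiteEdgeEquiv α β),
    submatrix_hessianMatrixAtOne_completeBipartiteGraph (m := (m : K)) (n := (n : K))
      (by rw [hα]) (by rw [hβ]) hm hn, det_smul, det_kronecker_one_ones, Fintype.card_prod, hα, hβ]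
  congr 4 <;> ring

theorem mainTheorem4_general [DecidableEq (completeBipartiteGraph α β).edgeSet] {m n : ℕ}
    (hα : Fintype.card α = m) (hβ : Fintype.card β = n) (hm : (m : K) ≠ 0) (hn : (n : K) ≠ 0) :
    ((completeBipartiteGraph α β).hessianMatrixAtOne K).det =
        (-1 : K) ^ (m * n - 1) * (2 : K) ^ ((m - 1) * (n - 1)) *
          (m : K) ^ (((m : ℤ) * n - m) * (n - 1) - 1) *
          (n : K) ^ (((m : ℤ) * n - n) * (m - 1) - 1) *
          ((m : K) + n - 1) * ((m : K) + n - 2) ∧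
      ((m : K) + n ≠ 1 → (m : K) + n ≠ 2 →
        ((completeBipartiteGraph α β).hessianMatrix K).det ≠ 0) := by
  have hm0 : m ≠ 0 := fun h => hm (by simp [h])
  have hn0 : n ≠ 0 := fun h => hn (by simp [h])
  have hdet := det_hessianMatrixAtOne_completeBipartiteGraph K hα hβ hm hn
  refine ⟨?_, fun hone htwo hzero => ?_⟩
  · rw [hdet, ← det_hessian_factors_eq_zpow hm hn hm0 hn0]
    ring
  · have h2 : (2 : K) ≠ 0 := two_ne_zero_of_natCast_add_ne_two hm hn htwo
    rw [det_hessianMatrixAtOne, hzero, map_zero] at hdet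
    simp [sub_ne_zero.2 hone, sub_ne_zero.2 htwo, hm, hn, h2] at hdet

end MainTheorem

theorem mainTheorem4 (K : Type*) [Field K] [CharZero K] (m n : ℕ) (hm : 1 ≤ m) (hn : 1 ≤ n)
    (hmn : 3 ≤ m + n) [Fintype (completeBipartiteGraph (Fin m) (Fin n)).edgeSet] :
    ((completeBipartiteGraph (Fin m) (Fin n)).hessianMatrixAtOne K).det =
        (-1 : K) ^ (m * n - 1) * (2 : K) ^ ((m - 1) * (n - 1)) *
          (m : K) ^ (((m : ℤ) * n - m) * (n - 1) - 1) *
          (n : K) ^ (((m : ℤ) * n - n) * (m - 1) - 1) *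
          ((m : K) + n - 1) * ((m : K) + n - 2) ∧
      ((completeBipartiteGraph (Fin m) (Fin n)).hessianMatrix K).det ≠ 0 := by
  have h := mainTheorem4_general K (Fintype.card_fin m) (Fintype.card_fin n)
    (Nat.cast_ne_zero.2 (by omega)) (Nat.cast_ne_zero.2 (by omega))
  exact h.imp_right fun h => h (by exact_mod_cast (by omega : m + n ≠ 1))
    (by exact_mod_cast (by omega : m + n ≠ 2))
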